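/- **Setting.** A simplicial complex $K$ over a finite set is a family of subsets closed under inclusion and containing $\emptyset$; $S_j(K)$ is the set of its $j$-faces (faces with $j+1$ elements), and $F\in\partial\bar F$ means that $F\subset\bar F$ are faces with $|\bar F|=|F|+1$. The cochain space $C^j(K)$ consists of the real functions $f$ on ordered $j$-faces that change by the sign of a permutation of the vertices. Given a positive weight $w$ on the faces, $C^j(K)$ has the inner product $\langle f,g\rangle=\sum_{F\in S_j(K)}w(F)f([F])g([F])$. The coboundary map $\delta_{j}:C^{j}(K)\to C^{j+1}(K)$ is $(\delta_{j}f)([v_0,\dots,v_{j+1}])=\sum_l(-1)^lf([v_0,\dots,\hat v_l,\dots,v_{j+1}])$, and the $i$-down Laplacian is $\mathcal L_i^{\mathrm{down}}(K)=\delta_{i-1}\delta_{i-1}^*$. An incidence-signed complex $(K,s)$ is a complex with a function $s:K\times K\to\{-1,0,1\}$ such that $s(F,\bar F)=\pm1$ if $F\in\partial\bar F$ and $s(F,\bar F)=0$ otherwise; its coboundary $\delta^s$ is $\delta$ with the $l$-th term multiplied by $s(\{v_0,\dots,\hat v_l,\dots,v_{j+1}\},\{v_0,\dots,v_{j+1}\})$,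 and $\mathcal L_i^{\mathrm{down}}(K,s)=\delta^s_{i-1}(\delta^s_{i-1})^*$. $\operatorname{Spec}$ is the multiset of eigenvalues, with multiplicity. A $2$-fold covering $\phi:K\to M$ is a map $V(K)\to V(M)$ on the vertices such that: $K$ is connected; $\phi$ maps faces to faces; for each $G\in M$ the faces $F$ of $K$ with $\phi(F)=G$ are pairwise disjoint, are mapped bijectively onto $G$, and have union $\phi^{-1}(G)$; if $G\in\partial\bar G$ in $M$ and $\phi(F)=G$, then there is $\bar F\in K$ with $F\in\partial\bar F$ and $\phi(\bar F)=\bar G$; and over each nonempty face of $M$ there are exactly two faces of $K$. The incidence graph $B_{i-1}(K)$ has vertex set $S_{i-1}(K)\cup S_i(K)$ and edges $\{F,\bar F\}$ for $F\in\partial\bar F$. A permutation assignment $\psi$ in $\mathbb S_2$ on a graph $B$ gives each arc $(u,v)$ a permutation $\psi(u,v)\in\mathbb S_2$ with $\psi(v,u)=\psi(u,v)^{-1}$; the derived graph $B^\psi$ has vertex set $V(B)\times\{1,2\}$, with $(u,a)$ and $(v,b)$ adjacent iff $u,v$ are adjacent in $B$ and $a=\psi(u,v)(b)$. **Theorem.**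 Let $i\ge1$, let $\phi:K\to M$ be a $2$-fold covering, and let $w_K,w_M$ be positive weights with $w_K(F)=w_M(\phi(F))$ for all $F\in S_{i-1}(K)\cup S_i(K)$. Then: 1. There are a permutation assignment $\psi$ in $\mathbb S_2$ on $B_{i-1}(M)$ and a graph isomorphism $\eta:B_{i-1}(M)^\psi\to B_{i-1}(K)$ with $\phi(\eta(G,a))=G$ for all $G\in S_{i-1}(M)\cup S_i(M)$ and $a\in\{1,2\}$. 2. For every such $\psi$ and $\eta$ there is an incidence signing $s$ of $M$ with $s(F,\bar F)=\operatorname{sgn}\psi(F,\bar F)$ for all $(F,\bar F)\in S_{i-1}(M)\times S_i(M)$ with $F\in\partial\bar F$, and for every such $s$, as a multiset union (multiplicities add), $$\operatorname{Spec}\mathcal L_i^{\mathrm{down}}(K)=\operatorname{Spec}\mathcal L_i^{\mathrm{down}}(M)\cup\operatorname{Spec}\mathcal L_i^{\mathrm{down}}(M,s).$$ -/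

import Mathlib

namespace CoverLap

/-! ### Simplicial complexes -/

/-- An abstract simplicial complex over `V`: a family of finite subsets of `V` that is closed under
inclusion and contains the empty simplex. -/
structure SimpComplex (V : Type*) where
  faces : Set (Finset V)
  empty_mem : ∅ ∈ faces
  down_closed : ∀ F ∈ faces, ∀ E ⊆ F, E ∈ faces

namespace SimpComplex

variable {V : Type*} (K : SimpComplex V)

/-- The simplices of `K`, of all dimensions. -/
abbrev Simplex : Type _ := {F : Finset V // F ∈ K.faces}

/-- The simplices with exactly `n` vertices, that is, the set `S_{n-1}(K)` of the
`(n-1)`-dimensional faces; `n = 0` gives the empty simplex. -/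
abbrev Face (n : ℕ) : Type _ := {F : K.Simplex // F.1.card = n}

/-- The vertices of `K`. -/
abbrev Vertex : Type _ := {v : V // {v} ∈ K.faces}

/-- The graph formed by the vertices and the edges of `K`. -/
def graph [DecidableEq V] : SimpleGraph K.Vertex where
  Adj u v := u ≠ v ∧ ({u.1, v.1} : Finset V) ∈ K.faces
  symm := ⟨fun u v h => ⟨h.1.symm, by rw [Finset.pair_comm]; exact h.2⟩⟩
  loopless := ⟨fun _ h => h.1 rfl⟩

end SimpComplex

/-- `F ∈ ∂ F'`: the simplex `F` is a codimension one face of `F'`. -/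
def IsFacetOf {V : Type*} (F F' : Finset V) : Prop := F ⊆ F' ∧ F'.card = F.card + 1

/-- A weight function on the simplices of `K`, with positive values. -/
structure Weight {V : Type*} (K : SimpComplex V) where
  val : K.Simplex → ℝ
  pos : ∀ F, 0 < val F

/-- An incidence signing of `K`: a function `s : K × K → {-1, 0, 1}` which is `±1` exactly on the
incidences of `K`. The pair `(K, s)` is an incidence-signed complex. -/
structure IncidenceSign {V : Type*} (K : SimpComplex V) where
  val : K.Simplex → K.Simplex → ℤ
  of_incident : ∀ F F', IsFacetOf F.1 F'.1 → val F F' = 1 ∨ val F F' = -1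
  of_not_incident : ∀ F F', ¬ IsFacetOf F.1 F'.1 → val F F' = 0

/-! ### Ordered simplices and cochains -/

section Cochains

variable {V : Type*} (K : SimpComplex V)

/-- The orderings `(v_0, …, v_{n-1})` of the simplices of `K` with `n` vertices. -/
abbrev OrdFace (n : ℕ) : Type _ := {v : Fin n ↪ V // Finset.univ.map v ∈ K.faces}

variable {K}

namespace OrdFace

/-- The simplex underlying an ordered simplex. -/
def simplex {n : ℕ} (v : OrdFace K n) : K.Simplex := ⟨Finset.univ.map v.1, v.2⟩

/-- Reordering the vertices: `(v_{σ 0}, …, v_{σ (n-1)})`. -/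
def perm {n : ℕ} (v : OrdFace K n) (σ : Equiv.Perm (Fin n)) : OrdFace K n :=
  ⟨σ.toEmbedding.trans v.1, by
    have h : Finset.univ.map (σ.toEmbedding.trans v.1) = Finset.univ.map v.1 := by
      rw [← Finset.map_map, Finset.map_univ_equiv]
    rw [h]; exact v.2⟩

/-- Omitting a vertex: `(v_0, …, v̂_j, …, v_n)`. -/
def del {n : ℕ} (v : OrdFace K (n + 1)) (j : Fin (n + 1)) : OrdFace K n :=
  ⟨(Fin.succAboveEmb j).trans v.1, by
    refine K.down_closed _ v.2 _ ?_
    rw [← Finset.map_map]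
    exact Finset.map_subset_map.2 (Finset.subset_univ _)⟩

@[simp] lemma simplex_perm {n : ℕ} (v : OrdFace K n) (σ : Equiv.Perm (Fin n)) :
    (v.perm σ).simplex = v.simplex := by
  apply Subtype.ext
  change Finset.univ.map (σ.toEmbedding.trans v.1) = Finset.univ.map v.1
  rw [← Finset.map_map, Finset.map_univ_equiv]

/-- Two orderings of the same simplex differ by a permutation. -/
lemma exists_perm {n : ℕ} {u v : OrdFace K n} (h : u.simplex = v.simplex) :
    ∃ σ : Equiv.Perm (Fin n), u = v.perm σ := by
  have hs : Finset.univ.map u.1 = Finset.univ.map v.1 := congrArg Subtype.val h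
  have hm : ∀ a, ∃ b, v.1 b = u.1 a := by
    intro a
    have : u.1 a ∈ Finset.univ.map v.1 := by
      rw [← hs]; exact Finset.mem_map_of_mem _ (Finset.mem_univ _)
    simpa using this
  choose g hg using hm
  have hinj : Function.Injective g := by
    intro a b hab
    apply u.1.injective
    rw [← hg a, ← hg b, hab]
  refine ⟨Equiv.ofBijective g (Finite.injective_iff_bijective.1 hinj), ?_⟩
  apply Subtype.ext
  ext a
  exact (hg a).symm

end OrdFace

/-- Some ordering of a simplex with `n` vertices exists. -/
lemma exists_ordering {n : ℕ} (F : K.Face n) : ∃ v : OrdFace K n, v.simplex = F.1 := by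
  obtain ⟨⟨F, hF⟩, rfl⟩ := F
  have h : Finset.univ.map (F.equivFin.symm.toEmbedding.trans (Function.Embedding.subtype _)) = F := by
    rw [← Finset.map_map, Finset.map_univ_equiv]
    ext x; simp
  exact ⟨⟨F.equivFin.symm.toEmbedding.trans (Function.Embedding.subtype _), h.symm ▸ hF⟩,
    Subtype.ext h⟩

/-- A reference ordering `[F]` of the simplex `F`. -/
noncomputable def ordering {n : ℕ} (F : K.Face n) : OrdFace K n := (exists_ordering F).choose

lemma simplex_ordering {n : ℕ} (F : K.Face n) : (ordering F).simplex = F.1 :=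
  (exists_ordering F).choose_spec

/-- The alternating functions on ordered simplices with `n` vertices. These are the linear forms on
the chain group `C_{n-1}(K, ℝ)`: ordered simplices with the same orientation have the same
value, and opposite orientations have opposite values. -/
def cochains (K : SimpComplex V) (n : ℕ) : Submodule ℝ (OrdFace K n → ℝ) where
  carrier := {f | ∀ (v : OrdFace K n) (σ : Equiv.Perm (Fin n)),
    f (v.perm σ) = ((Equiv.Perm.sign σ : ℤ) : ℝ) * f v}
  add_mem' := by
    intro f g hf hg v σ
    simp only [Pi.add_apply, hf v σ, hg v σ]; ring
  zero_mem' := by intro v σ; simp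
  smul_mem' := by
    intro c f hf v σ
    simp only [Pi.smul_apply, smul_eq_mul, hf v σ]; ring

/-- The cochain group `C^{n-1}(K, ℝ)`, as a type that will carry the inner product
given by the weight `w`. -/
def Cochain (K : SimpComplex V) (_w : Weight K) (n : ℕ) : Type _ := cochains K n

noncomputable instance (w : Weight K) (n : ℕ) : AddCommGroup (Cochain K w n) :=
  inferInstanceAs (AddCommGroup (cochains K n))

noncomputable instance (w : Weight K) (n : ℕ) : Module ℝ (Cochain K w n) :=
  inferInstanceAs (Module ℝ (cochains K n))

noncomputable instance [Fintype V] (n : ℕ) : Fintype (OrdFace K n) := Fintype.ofFinite _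

noncomputable instance [Fintype V] (n : ℕ) : Fintype (K.Face n) := Fintype.ofFinite _

instance [Fintype V] (w : Weight K) (n : ℕ) : FiniteDimensional ℝ (Cochain K w n) :=
  inferInstanceAs (FiniteDimensional ℝ (cochains K n))

/-- The value of a cochain at an ordered simplex. -/
def Cochain.eval {w : Weight K} {n : ℕ} (f : Cochain K w n) (v : OrdFace K n) : ℝ := f.1 v

/-- The cochain given by an alternating function. -/
def Cochain.mk {w : Weight K} {n : ℕ} (f : OrdFace K n → ℝ)
    (hf : ∀ (v : OrdFace K n) (σ : Equiv.Perm (Fin n)),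
      f (v.perm σ) = ((Equiv.Perm.sign σ : ℤ) : ℝ) * f v) : Cochain K w n := ⟨f, hf⟩

namespace Cochain

variable {w : Weight K} {n : ℕ}

lemma ext_eval {f g : Cochain K w n} (h : ∀ v, f.eval v = g.eval v) : f = g :=
  Subtype.ext (funext h)

lemma eval_perm (f : Cochain K w n) (v : OrdFace K n) (σ : Equiv.Perm (Fin n)) :
    f.eval (v.perm σ) = ((Equiv.Perm.sign σ : ℤ) : ℝ) * f.eval v := f.2 v σ

@[simp] lemma eval_mk (f : OrdFace K n → ℝ) (hf) (v : OrdFace K n) :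
    (Cochain.mk f hf : Cochain K w n).eval v = f v := rfl

@[simp] lemma eval_add (f g : Cochain K w n) (v : OrdFace K n) :
    (f + g).eval v = f.eval v + g.eval v := rfl

@[simp] lemma eval_smul (c : ℝ) (f : Cochain K w n) (v : OrdFace K n) :
    (c • f).eval v = c * f.eval v := rfl

@[simp] lemma eval_zero (v : OrdFace K n) : (0 : Cochain K w n).eval v = 0 := rfl

/-- The product of two cochains does not depend on the ordering of the simplex. -/
lemma eval_mul_eval_eq (f g : Cochain K w n) {u v : OrdFace K n} (h : u.simplex = v.simplex) :
    f.eval u * g.eval u = f.eval v * g.eval v := by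
  obtain ⟨σ, rfl⟩ := OrdFace.exists_perm h
  rw [eval_perm, eval_perm]
  rcases Int.units_eq_one_or (Equiv.Perm.sign σ) with h | h <;> simp [h]

/-- The weighted inner product `∑_F w(F) f([F]) g([F])`. -/
noncomputable instance innerCore [Fintype V] (w : Weight K) (n : ℕ) :
    InnerProductSpace.Core ℝ (Cochain K w n) where
  inner f g := ∑ F : K.Face n, w.val F.1 * f.eval (ordering F) * g.eval (ordering F)
  conj_inner_symm f g := by
    simp only [conj_trivial]
    exact Finset.sum_congr rfl fun F _ => by ring
  re_inner_nonneg f := by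
    simp only [RCLike.re_to_real]
    refine Finset.sum_nonneg fun F _ => ?_
    rw [mul_assoc]
    exact mul_nonneg (w.pos _).le (mul_self_nonneg _)
  add_left f g h := by
    simp only [eval_add]
    rw [← Finset.sum_add_distrib]
    exact Finset.sum_congr rfl fun F _ => by ring
  smul_left f g c := by
    simp only [eval_smul, conj_trivial]
    rw [Finset.mul_sum]
    exact Finset.sum_congr rfl fun F _ => by ring
  definite f hf := by
    have h0 : ∀ F ∈ (Finset.univ : Finset (K.Face n)),
        0 ≤ w.val F.1 * f.eval (ordering F) * f.eval (ordering F) := by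
      intro F _
      rw [mul_assoc]
      exact mul_nonneg (w.pos _).le (mul_self_nonneg _)
    have h1 := (Finset.sum_eq_zero_iff_of_nonneg h0).1 hf
    apply ext_eval
    intro v
    have hc : v.simplex.1.card = n := by simp [OrdFace.simplex]
    have h2 := h1 ⟨v.simplex, hc⟩ (Finset.mem_univ _)
    rw [mul_assoc] at h2
    rw [eval_mul_eval_eq f f (v := v) (simplex_ordering _)] at h2
    simpa [(w.pos _).ne'] using h2

noncomputable instance [Fintype V] (w : Weight K) (n : ℕ) : NormedAddCommGroup (Cochain K w n) :=
  (innerCore w n).toNormedAddCommGroup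

noncomputable instance [Fintype V] (w : Weight K) (n : ℕ) : InnerProductSpace ℝ (Cochain K w n) :=
  InnerProductSpace.ofCore (innerCore w n).toCore

end Cochain

/-- Deleting the entry `j` after a reordering `σ` is a reordering of the deletion of the entry
`σ j`, and the signs match. -/
lemma OrdFace.exists_del_perm {n : ℕ} (σ : Equiv.Perm (Fin (n + 1))) (j : Fin (n + 1)) :
    ∃ τ : Equiv.Perm (Fin n), (∀ v : OrdFace K (n + 1), (v.perm σ).del j = (v.del (σ j)).perm τ) ∧
      (-1 : ℤ) ^ (j : ℕ) * (Equiv.Perm.sign τ : ℤ) =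
        (Equiv.Perm.sign σ : ℤ) * (-1) ^ ((σ j : Fin (n + 1)) : ℕ) := by
  obtain ⟨⟨p, τ⟩, hρ⟩ : ∃ q : Fin (n + 1) × Equiv.Perm (Fin n),
      Equiv.Perm.decomposeFin.symm q = (σ j).cycleRange * σ * j.cycleRange⁻¹ :=
    ⟨_, Equiv.Perm.decomposeFin.symm_apply_apply _⟩
  have hp : p = 0 := by
    have h := congrArg (fun f : Equiv.Perm (Fin (n + 1)) => f 0) hρ
    simp only [Equiv.Perm.decomposeFin_symm_apply_zero, Equiv.Perm.mul_apply] at h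
    rw [h]
    change (σ j).cycleRange (σ (j.cycleRange.symm 0)) = 0
    rw [Fin.cycleRange_symm_zero, Fin.cycleRange_self]
  subst hp
  have key : ∀ a, σ (j.succAbove a) = (σ j).succAbove (τ a) := by
    intro a
    apply (σ j).cycleRange.injective
    rw [Fin.cycleRange_succAbove]
    have h := congrArg (fun f : Equiv.Perm (Fin (n + 1)) => f a.succ) hρ
    simp only [Equiv.Perm.decomposeFin_symm_apply_succ, Equiv.Perm.mul_apply, Equiv.swap_self,
      Equiv.refl_apply] at h
    rw [h]
    change _ = (σ j).cycleRange (σ (j.cycleRange.symm a.succ))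
    rw [Fin.cycleRange_symm_succ]
  refine ⟨τ, fun v => ?_, ?_⟩
  · apply Subtype.ext
    ext a
    exact congrArg v.1 (key a)
  · have h := congrArg (fun f => (Equiv.Perm.sign f : ℤ)) hρ
    simp only [Equiv.Perm.decomposeFin.symm_sign, if_true, one_mul, map_mul, Fin.sign_cycleRange,
      Equiv.Perm.sign_inv, Units.val_mul, Units.val_pow_eq_pow_val, Units.val_neg,
      Units.val_one] at h
    rw [h]
    have hj : (-1 : ℤ) ^ (j : ℕ) * (-1) ^ (j : ℕ) = 1 := by
      rw [← mul_pow]; simp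
    linear_combination (-1 : ℤ) ^ ((σ j : Fin (n + 1)) : ℕ) * (Equiv.Perm.sign σ : ℤ) * hj

/-- The coboundary map with coefficients `c`:
`(δ f)([v_0, …, v_n]) = ∑_j (-1)^j c({v_0, …, v̂_j, …, v_n}, {v_0, …, v_n}) f([v_0, …, v̂_j, …, v_n])`.
It is the conjugate of the boundary map whose incidences are multiplied by `c`. -/
noncomputable def coboundaryWith (w : Weight K) (c : K.Simplex → K.Simplex → ℝ) (n : ℕ) :
    Cochain K w n →ₗ[ℝ] Cochain K w (n + 1) where
  toFun f := Cochain.mk (fun v => ∑ j : Fin (n + 1),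
      (-1) ^ (j : ℕ) * c (v.del j).simplex v.simplex * f.eval (v.del j)) (by
    intro v σ
    rw [← Equiv.sum_comp σ (fun j : Fin (n + 1) =>
      (-1) ^ (j : ℕ) * c (v.del j).simplex v.simplex * f.eval (v.del j)), Finset.mul_sum]
    refine Finset.sum_congr rfl fun j _ => ?_
    obtain ⟨τ, h1, h2⟩ := OrdFace.exists_del_perm (K := K) σ j
    have h3 : (-1 : ℝ) ^ (j : ℕ) * ((Equiv.Perm.sign τ : ℤ) : ℝ) =
        ((Equiv.Perm.sign σ : ℤ) : ℝ) * (-1) ^ ((σ j : Fin (n + 1)) : ℕ) := by exact_mod_cast h2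
    rw [h1 v, OrdFace.simplex_perm, OrdFace.simplex_perm, Cochain.eval_perm]
    linear_combination c (v.del (σ j)).simplex v.simplex * f.eval (v.del (σ j)) * h3)
  map_add' f g := by
    apply Cochain.ext_eval
    intro v
    simp only [Cochain.eval_mk, Cochain.eval_add, mul_add, Finset.sum_add_distrib]
  map_smul' a f := by
    apply Cochain.ext_eval
    intro v
    simp only [Cochain.eval_mk, Cochain.eval_smul, RingHom.id_apply, Finset.mul_sum]
    exact Finset.sum_congr rfl fun j _ => by ring

/-- The coboundary map `δ_{n-1} : C^{n-1}(K) → C^n(K)`. -/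
noncomputable def coboundary (K : SimpComplex V) (w : Weight K) (n : ℕ) :
    Cochain K w n →ₗ[ℝ] Cochain K w (n + 1) :=
  coboundaryWith w (fun _ _ => 1) n

/-- The signed coboundary map `δ^s_{n-1} : C^{n-1}(K) → C^n(K)` of `(K, s)`. -/
noncomputable def signedCoboundary (K : SimpComplex V) (w : Weight K) (s : IncidenceSign K)
    (n : ℕ) : Cochain K w n →ₗ[ℝ] Cochain K w (n + 1) :=
  coboundaryWith w (fun F F' => (s.val F F' : ℝ)) n

variable [Fintype V]

/-- The `i`-down Laplace operator `δ_{i-1} δ_{i-1}^*` on `C^i(K)`, where the adjoint is taken with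
respect to the weighted inner products. -/
noncomputable def downLaplacian (K : SimpComplex V) (w : Weight K) (i : ℕ) :
    Cochain K w (i + 1) →ₗ[ℝ] Cochain K w (i + 1) :=
  coboundary K w i ∘ₗ LinearMap.adjoint (coboundary K w i)

/-- The `i`-down Laplace operator `δ^s_{i-1} (δ^s_{i-1})^*` of the incidence-signed complex
`(K, s)`. -/
noncomputable def signedDownLaplacian (K : SimpComplex V) (w : Weight K) (s : IncidenceSign K)
    (i : ℕ) : Cochain K w (i + 1) →ₗ[ℝ] Cochain K w (i + 1) :=
  signedCoboundary K w s i ∘ₗ LinearMap.adjoint (signedCoboundary K w s i)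

end Cochains

/-- The spectrum of an endomorphism of a finite-dimensional real space as a multiset: the roots of
the characteristic polynomial with multiplicity. (The Laplace operators above are self-adjoint, so
all their eigenvalues are real.) -/
noncomputable def spec {E : Type*} [AddCommGroup E] [Module ℝ E] [FiniteDimensional ℝ E]
    (L : E →ₗ[ℝ] E) : Multiset ℝ := L.charpoly.roots

/-! ### Coverings -/

section Coverings

variable {V W : Type*} [DecidableEq V] [DecidableEq W]

/-- The simplices of `K` lying over `G`. -/
def lifts (φ : V → W) (K : SimpComplex V) (G : Finset W) : Set (Finset V) :=
  {F | F ∈ K.faces ∧ F.image φ = G}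

/-- `φ` (of which only the values at vertices of `K` matter) is a covering map `K → M`:
`K` is connected, `φ` is simplicial, and for each simplex `G` of `M` the preimage of `G` is the
union of the simplices over `G`, which are pairwise disjoint and mapped bijectively onto `G`. -/
structure IsCovering (φ : V → W) (K : SimpComplex V) (M : SimpComplex W) : Prop where
  connected : K.graph.Connected
  simplicial : ∀ F ∈ K.faces, F.image φ ∈ M.faces
  preimage_eq : ∀ G ∈ M.faces, {v : V | {v} ∈ K.faces ∧ φ v ∈ G} = ⋃ F ∈ lifts φ K G, (F : Set V)
  pairwise_disjoint : ∀ G ∈ M.faces, (lifts φ K G).Pairwise Disjoint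
  bijOn : ∀ G ∈ M.faces, ∀ F ∈ lifts φ K G, Set.BijOn φ F G

/-- A strong covering: incidences `G ∈ ∂ G'` of `M` lift at every simplex over `G`. -/
structure IsStrongCovering (φ : V → W) (K : SimpComplex V) (M : SimpComplex W) : Prop
    extends IsCovering φ K M where
  lift_incidence : ∀ G ∈ M.faces, ∀ G' ∈ M.faces, IsFacetOf G G' →
    ∀ F ∈ lifts φ K G, ∃ F' ∈ lifts φ K G', IsFacetOf F F'

/-- A `k`-fold covering: a strong covering such that over each nonempty simplex of `M` there are
exactly `k` simplices of `K`. -/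
structure IsFoldCovering (k : ℕ) (φ : V → W) (K : SimpComplex V) (M : SimpComplex W) : Prop
    extends IsStrongCovering φ K M where
  degree : ∀ G ∈ M.faces, G.Nonempty → (lifts φ K G).ncard = k

end Coverings

/-! ### Incidence graphs and derived graphs -/

/-- The incidence graph `B_{n-1}(K)` on `S_{n-1}(K) ∪ S_n(K)`, where `F` and `F'` are adjacent when
`F ∈ ∂ F'`. -/
def incidenceGraph {V : Type*} (K : SimpComplex V) (n : ℕ) :
    SimpleGraph (K.Face n ⊕ K.Face (n + 1)) where
  Adj
    | .inl F, .inr F' => IsFacetOf F.1.1 F'.1.1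
    | .inr F', .inl F => IsFacetOf F.1.1 F'.1.1
    | _, _ => False
  symm := ⟨by rintro (F | F) (F' | F') h <;> exact h⟩
  loopless := ⟨by rintro (F | F) h <;> exact h⟩

/-- The simplex of `K` that a vertex of the incidence graph stands for. -/
def incidenceGraphSimplex {V : Type*} {K : SimpComplex V} {n : ℕ} :
    K.Face n ⊕ K.Face (n + 1) → K.Simplex :=
  Sum.elim (fun F => F.1) (fun F => F.1)

/-- An assignment of permutations of `k` letters to the arcs of a simple graph such that opposite
arcs have inverse permutations. -/
structure VoltageAssignment {X : Type*} (G : SimpleGraph X) (k : ℕ) where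
  val : G.Dart → Equiv.Perm (Fin k)
  val_symm : ∀ d, val d.symm = (val d)⁻¹

/-- The derived graph `G^ψ`: `(u, a)` and `(v, b)` are adjacent when `u` and `v` are
and `a = ψ(u, v)(b)`. -/
def derivedGraph {X : Type*} {G : SimpleGraph X} {k : ℕ} (ψ : VoltageAssignment G k) :
    SimpleGraph (X × Fin k) where
  Adj p q := ∃ h : G.Adj p.1 q.1, p.2 = ψ.val ⟨(p.1, q.1), h⟩ q.2
  symm := ⟨by
    rintro p q ⟨h, e⟩
    refine ⟨h.symm, ?_⟩
    have hs := ψ.val_symm ⟨(p.1, q.1), h⟩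
    change ψ.val ⟨(q.1, p.1), h.symm⟩ = _ at hs
    rw [hs, e]
    exact (Equiv.symm_apply_apply _ _).symm⟩
  loopless := ⟨fun p ⟨h, _⟩ => G.loopless.irrefl _ h⟩

/-- The isomorphism `η : B_{n-1}(M)^ψ ≅ B_{n-1}(K)` is compatible with the covering map `φ`:
`φ(η(G, a)) = G`. -/
def IsCompatible {V W : Type*} [DecidableEq W] (φ : V → W) {K : SimpComplex V} {M : SimpComplex W}
    {n k : ℕ} {ψ : VoltageAssignment (incidenceGraph M n) k}
    (η : derivedGraph ψ ≃g incidenceGraph K n) : Prop :=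
  ∀ (x : M.Face n ⊕ M.Face (n + 1)) (a : Fin k),
    (incidenceGraphSimplex (η (x, a))).1.image φ = (incidenceGraphSimplex x).1

/-- `s(F, F') = sgn ψ(F, F')` for all `F ∈ S_{n-1}(M)` and `F' ∈ S_n(M)` with `F ∈ ∂ F'`. -/
def IsSignOf {W : Type*} {M : SimpComplex W} {n k : ℕ} (s : IncidenceSign M)
    (ψ : VoltageAssignment (incidenceGraph M n) k) : Prop :=
  ∀ (F : M.Face n) (F' : M.Face (n + 1)) (h : (incidenceGraph M n).Adj (.inl F) (.inr F')),
    s.val F.1 F'.1 = (Equiv.Perm.sign (ψ.val ⟨(.inl F, .inr F'), h⟩) : ℤ)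

end CoverLap

open CoverLap

/-!
A numbering of the two sheets identifies the real functions on a fibre of `φ` with functions on
`{1, 2}`, which decompose into the trivial and the sign character of `𝕊₂`. Thus a cochain of `K` is
uniquely the sum of the pullback of a cochain of `M` and of a pullback multiplied by the sign of the
sheet. The two kinds of pullbacks are orthogonal, and both multiply inner products by `2`. The
coboundary of `K` acts on the former as the coboundary of `M`, and on the latter as the coboundary
of `(M, s)`, because the sheets of incident faces differ by the permutation `ψ`. Hence
the adjoint of the coboundary respects the decomposition as well, and so does the down Laplacian.
-/

namespace CoverLap

section OrthogonalSum

open LinearMap (adjoint)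
open Module (finrank)

variable {𝕜 E F G E' F' G' : Type*} [RCLike 𝕜]
  [NormedAddCommGroup E] [InnerProductSpace 𝕜 E] [NormedAddCommGroup F] [InnerProductSpace 𝕜 F]
  [NormedAddCommGroup G] [InnerProductSpace 𝕜 G] [NormedAddCommGroup E'] [InnerProductSpace 𝕜 E']
  [NormedAddCommGroup F'] [InnerProductSpace 𝕜 F'] [NormedAddCommGroup G'] [InnerProductSpace 𝕜 G']

/-- `E` is the orthogonal sum of the ranges of `A` and `B`, both of which multiply inner products
by `c`. That the ranges span `E` is encoded by dimensions. -/
structure IsOrthogonalSum (c : 𝕜) (A : F →ₗ[𝕜] E) (B : G →ₗ[𝕜] E) : Prop where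
  scale_ne_zero : c ≠ 0
  inner_left : ∀ x y, inner 𝕜 (A x) (A y) = c * inner 𝕜 x y
  inner_right : ∀ x y, inner 𝕜 (B x) (B y) = c * inner 𝕜 x y
  inner_left_right : ∀ x y, inner 𝕜 (A x) (B y) = 0
  finrank_eq : finrank 𝕜 E = finrank 𝕜 F + finrank 𝕜 G

namespace IsOrthogonalSum

variable {c : 𝕜} {A : F →ₗ[𝕜] E} {B : G →ₗ[𝕜] E} {A' : F' →ₗ[𝕜] E'} {B' : G' →ₗ[𝕜] E'}

lemma symm (h : IsOrthogonalSum c A B) : IsOrthogonalSum c B A where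
  scale_ne_zero := h.scale_ne_zero
  inner_left := h.inner_right
  inner_right := h.inner_left
  inner_left_right x y := inner_eq_zero_symm.1 (h.inner_left_right y x)
  finrank_eq := h.finrank_eq.trans (add_comm _ _)

lemma eq_zero_of_add_eq_zero (h : IsOrthogonalSum c A B) {x : F} {y : G} (hxy : A x + B y = 0) :
    x = 0 := by
  have hx : c * inner 𝕜 x x = 0 := calc
    c * inner 𝕜 x x = inner 𝕜 (A x) (A x + B y) := by
      rw [inner_add_right, h.inner_left, h.inner_left_right, add_zero]
    _ = 0 := by rw [hxy, inner_zero_right]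
  simpa only [mul_eq_zero, h.scale_ne_zero, false_or, inner_self_eq_zero] using hx

lemma coprod_injective (h : IsOrthogonalSum c A B) : Function.Injective (A.coprod B) := by
  refine LinearMap.ker_eq_bot.1 (LinearMap.ker_eq_bot'.2 fun ⟨x, y⟩ hxy => ?_)
  rw [LinearMap.coprod_apply] at hxy
  exact Prod.ext (h.eq_zero_of_add_eq_zero hxy)
    (h.symm.eq_zero_of_add_eq_zero ((add_comm _ _).trans hxy))

variable [FiniteDimensional 𝕜 E] [FiniteDimensional 𝕜 F] [FiniteDimensional 𝕜 G]

/-- The isomorphism `F × G ≃ E` given by an orthogonal sum. -/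
noncomputable def prodEquiv (h : IsOrthogonalSum c A B) : (F × G) ≃ₗ[𝕜] E :=
  LinearEquiv.ofInjectiveOfFinrankEq (A.coprod B) h.coprod_injective
    (Module.finrank_prod.trans h.finrank_eq.symm)

lemma prodEquiv_apply (h : IsOrthogonalSum c A B) (p : F × G) :
    h.prodEquiv p = A p.1 + B p.2 := rfl

variable [FiniteDimensional 𝕜 E'] [FiniteDimensional 𝕜 F']
  {d : E →ₗ[𝕜] E'} {a : F →ₗ[𝕜] F'} {b : G →ₗ[𝕜] G'}

lemma adjoint_apply_left (h : IsOrthogonalSum c A B) (h' : IsOrthogonalSum c A' B')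
    (ha : ∀ x, d (A x) = A' (a x)) (hb : ∀ y, d (B y) = B' (b y)) (z : F') :
    adjoint d (A' z) = A (adjoint a z) := by
  refine ext_inner_left 𝕜 fun e => ?_
  obtain ⟨⟨x, y⟩, rfl⟩ := h.prodEquiv.surjective e
  simp only [LinearMap.adjoint_inner_right, prodEquiv_apply, map_add, inner_add_left, ha, hb,
    h'.inner_left, h.inner_left, h'.symm.inner_left_right, h.symm.inner_left_right]

theorem charpoly_comp_adjoint [FiniteDimensional 𝕜 G'] (h : IsOrthogonalSum c A B)
    (h' : IsOrthogonalSum c A' B') (ha : ∀ x, d (A x) = A' (a x)) (hb : ∀ y, d (B y) = B' (b y)) :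
    (d ∘ₗ adjoint d).charpoly = (a ∘ₗ adjoint a).charpoly * (b ∘ₗ adjoint b).charpoly := by
  have hconj : d ∘ₗ adjoint d =
      h'.prodEquiv.conj ((a ∘ₗ adjoint a).prodMap (b ∘ₗ adjoint b)) := by
    rw [LinearEquiv.conj_apply, LinearEquiv.eq_comp_toLinearMap_symm]
    refine LinearMap.ext fun p => ?_
    simp only [LinearMap.comp_apply, LinearEquiv.coe_coe, prodEquiv_apply, map_add,
      LinearMap.prodMap_apply, h.adjoint_apply_left h' ha hb,
      h.symm.adjoint_apply_left h'.symm hb ha, ha, hb]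
  rw [hconj, LinearEquiv.charpoly_conj, LinearMap.charpoly_prodMap]

end IsOrthogonalSum

end OrthogonalSum

section SheetLabelling

variable {X X' Y Y' A : Type*}

/-- The labels `s` number the sheets of `p`: in each fibre of `p` each label occurs exactly once. -/
def IsSheetLabelling (p : Y → X) (s : Y → A) : Prop :=
  Function.Bijective fun y => (p y, s y)

lemma exists_isSheetLabelling {p : Y → X} {k : ℕ} [NeZero k]
    (hp : ∀ x, {y | p y = x}.ncard = k) : ∃ s : Y → Fin k, IsSheetLabelling p s := by
  have e (x : X) : {y // p y = x} ≃ Fin k :=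
    have : Finite {y // p y = x} :=
      Set.finite_of_ncard_ne_zero ((hp x).trans_ne (NeZero.ne k))
    Finite.equivFinOfCardEq (hp x)
  let E : Y ≃ X × Fin k := (Equiv.sigmaFiberEquiv p).symm.trans
    ((Equiv.sigmaCongrRight e).trans (Equiv.sigmaEquivProd X (Fin k)))
  exact ⟨fun y => (E y).2, E.bijective⟩

lemma isSheetLabelling_sumMap {p : Y → X} {p' : Y' → X'} {s : Y ⊕ Y' → A} :
    IsSheetLabelling (Sum.map p p') s ↔
      IsSheetLabelling p (s ∘ Sum.inl) ∧ IsSheetLabelling p' (s ∘ Sum.inr) := by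
  have hsum : Sum.map (fun y => (p y, s (.inl y))) (fun y => (p' y, s (.inr y))) =
      Equiv.sumProdDistrib X X' A ∘ fun y => (Sum.map p p' y, s y) := by
    ext (y | y) <;> rfl
  unfold IsSheetLabelling
  rw [← Equiv.comp_bijective _ (Equiv.sumProdDistrib X X' A), ← hsum, Sum.map_bijective]
  rfl

namespace IsSheetLabelling

variable {p : Y → X} {s : Y → A}

lemma eq_of_eq (hs : IsSheetLabelling p s) {y z : Y} (hp : p y = p z) (hyz : s y = s z) : y = z :=
  hs.injective (Prod.ext hp hyz)

lemma exists_eq (hs : IsSheetLabelling p s) (x : X) (a : A) : ∃ y, p y = x ∧ s y = a := by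
  simpa only [Prod.mk.injEq] using hs.surjective (x, a)

lemma sum_mul [Fintype X] [Fintype Y] [Fintype A] {R : Type*} [NonUnitalNonAssocSemiring R]
    (hs : IsSheetLabelling p s) (u : X → R) (v : A → R) :
    ∑ y, u (p y) * v (s y) = (∑ x, u x) * ∑ a, v a := by
  rw [hs.sum_comp fun q : X × A => u q.1 * v q.2, Fintype.sum_mul_sum, Fintype.sum_prod_type]

end IsSheetLabelling

end SheetLabelling

section GraphCovering

lemma bijOn_of_bijOn_comp {X Y Z : Type*} {p : X → Y} {q : Y → Z} {s : Set X} {t : Set Y}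
    {u : Set Z} (hq : Function.Injective q) (hqp : Set.BijOn (q ∘ p) s u) (ht : Set.BijOn q t u) :
    Set.BijOn p s t := by
  have himage : p '' s = t := hq.image_injective (by
    rw [← Set.image_comp, hqp.image_eq, ht.image_eq])
  exact himage ▸ hqp.injOn.of_comp.bijOn_image

variable {X Y : Type*} {A : SimpleGraph X} {B : SimpleGraph Y} {p : Y → X} {k : ℕ} {s : Y → Fin k}

/-- A covering map of graphs `p : B → A`: the neighbourhood of each `y` is mapped bijectively onto
the neighbourhood of `p y`. -/
def IsGraphCovering (B : SimpleGraph Y) (A : SimpleGraph X) (p : Y → X) : Prop :=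
  ∀ y, Set.BijOn p (B.neighborSet y) (A.neighborSet (p y))

namespace IsGraphCovering

lemma adj_map (hp : IsGraphCovering B A p) {y z : Y} (h : B.Adj y z) : A.Adj (p y) (p z) :=
  (hp y).mapsTo h

lemma exists_perm_adj_iff (hp : IsGraphCovering B A p) (hs : IsSheetLabelling p s) (d : A.Dart) :
    ∃ π : Equiv.Perm (Fin k), ∀ y z, p y = d.fst → p z = d.snd → (B.Adj y z ↔ s y = π (s z)) := by
  have hlabel (x x' : X) (b : Fin k) : ∃ a, A.Adj x x' →
      ∀ y z, p y = x → p z = x' → s z = b → (B.Adj y z ↔ s y = a) := by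
    obtain ⟨z, rfl, rfl⟩ := hs.exists_eq x' b
    by_cases hx : A.Adj x (p z)
    swap
    · exact ⟨s z, fun h => (hx h).elim⟩
    obtain ⟨y, hzy, rfl⟩ := (hp z).surjOn hx.symm
    refine ⟨s y, fun _ y' z' hy' hz' hzz' => ?_⟩
    obtain rfl := hs.eq_of_eq hz' hzz'
    refine ⟨fun h => congrArg s ((hp z').injOn h.symm hzy hy'), fun h => ?_⟩
    rw [hs.eq_of_eq hy' h]
    exact hzy.symm
  choose r hr using hlabel
  have hinv {x x' : X} (h : A.Adj x x') (b : Fin k) : r x' x (r x x' b) = b := by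
    obtain ⟨z, rfl, rfl⟩ := hs.exists_eq x' b
    obtain ⟨y, rfl, hy⟩ := hs.exists_eq x (r x (p z) (s z))
    have hyz : B.Adj y z := (hr _ _ _ h y z rfl rfl rfl).2 hy
    rw [← hy, ← (hr _ _ _ h.symm z y rfl rfl rfl).1 hyz.symm]
  exact ⟨⟨r d.fst d.snd, r d.snd d.fst, hinv d.adj, hinv d.adj.symm⟩,
    fun y z hy hz => hr _ _ _ d.adj y z hy hz rfl⟩

theorem exists_derivedGraph_iso (hp : IsGraphCovering B A p) (hs : IsSheetLabelling p s) :
    ∃ (ψ : VoltageAssignment A k) (η : derivedGraph ψ ≃g B), ∀ y, η.symm y = (p y, s y) := by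
  choose π hπ using hp.exists_perm_adj_iff hs
  have hπ_symm (d : A.Dart) : π d.symm = (π d)⁻¹ := by
    refine (eq_inv_iff_mul_eq_one).2 (Equiv.ext fun b => ?_)
    obtain ⟨y, hy, rfl⟩ := hs.exists_eq d.snd b
    obtain ⟨z, hz, hzy⟩ := hs.exists_eq d.fst (π d (s y))
    have hadj : B.Adj z y := (hπ d z y hz hy).2 hzy
    rw [Equiv.Perm.mul_apply, ← hzy, ← (hπ d.symm y z hy hz).1 hadj.symm, Equiv.Perm.one_apply]
  let ψ : VoltageAssignment A k := ⟨π, hπ_symm⟩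
  let e : B ≃g derivedGraph ψ :=
    { toEquiv := Equiv.ofBijective _ hs
      map_rel_iff' := fun {y z} =>
        ⟨fun ⟨h, hyz⟩ => (hπ ⟨(p y, p z), h⟩ y z rfl rfl).2 hyz,
          fun h => ⟨hp.adj_map h, (hπ ⟨(p y, p z), _⟩ y z rfl rfl).1 h⟩⟩ }
  exact ⟨ψ, e.symm, fun _ => rfl⟩

end IsGraphCovering

end GraphCovering

section Cochains

variable {V : Type*} {K : SimpComplex V} {n : ℕ}

namespace OrdFace

lemma card_simplex (v : OrdFace K n) : v.simplex.1.card = n := by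
  simp [simplex]

/-- The simplex underlying an ordered simplex, as an element of `S_{n-1}(K)`. -/
def toFace (v : OrdFace K n) : K.Face n := ⟨v.simplex, v.card_simplex⟩

@[simp] lemma toFace_perm (v : OrdFace K n) (σ : Equiv.Perm (Fin n)) :
    (v.perm σ).toFace = v.toFace :=
  Subtype.ext (v.simplex_perm σ)

lemma perm_perm (v : OrdFace K n) (σ τ : Equiv.Perm (Fin n)) :
    (v.perm σ).perm τ = v.perm (σ * τ) := rfl

lemma perm_eq_self_iff {v : OrdFace K n} {σ : Equiv.Perm (Fin n)} : v.perm σ = v ↔ σ = 1 := by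
  refine ⟨fun h => Equiv.ext fun j => v.1.injective ?_, fun h => h ▸ rfl⟩
  exact congrArg (fun u : OrdFace K n => u.1 j) h

lemma isFacetOf_del (v : OrdFace K (n + 1)) (j : Fin (n + 1)) :
    IsFacetOf (v.del j).toFace.1.1 v.toFace.1.1 := by
  refine ⟨?_, v.toFace.2.trans (congrArg (· + 1) (v.del j).toFace.2.symm)⟩
  intro x hx
  obtain ⟨i, -, rfl⟩ := Finset.mem_map.1 hx
  exact Finset.mem_map_of_mem v.1 (Finset.mem_univ (j.succAbove i))

end OrdFace

@[simp] lemma toFace_ordering (F : K.Face n) : (ordering F).toFace = F :=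
  Subtype.ext (simplex_ordering F)

namespace Cochain

variable {w : Weight K}

lemma eval_coboundaryWith (c : K.Simplex → K.Simplex → ℝ) (f : Cochain K w n)
    (v : OrdFace K (n + 1)) :
    (coboundaryWith w c n f).eval v =
      ∑ j : Fin (n + 1), (-1) ^ (j : ℕ) * c (v.del j).simplex v.simplex * f.eval (v.del j) := rfl

lemma inner_eq_sum [Fintype V] (f g : Cochain K w n) :
    inner ℝ f g = ∑ F : K.Face n, w.val F.1 * f.eval (ordering F) * g.eval (ordering F) := rfl

/-- The alternating sum of `g` over the orderings of a simplex. -/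
noncomputable def alternate (w : Weight K) (g : OrdFace K n → ℝ) : Cochain K w n :=
  Cochain.mk (fun v => ∑ σ : Equiv.Perm (Fin n), ((Equiv.Perm.sign σ : ℤ) : ℝ) * g (v.perm σ))
    fun v τ => by
      rw [Finset.mul_sum]
      refine Fintype.sum_equiv (Equiv.mulLeft τ) _ _ fun σ => ?_
      rw [Equiv.coe_mulLeft, v.perm_perm, Equiv.Perm.sign_mul, ← mul_assoc]
      rcases Int.units_eq_one_or (Equiv.Perm.sign τ) with h | h <;> simp [h]

lemma exists_eval_ordering_eq (w : Weight K) (x : K.Face n → ℝ) :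
    ∃ f : Cochain K w n, ∀ F, f.eval (ordering F) = x F := by
  classical
  refine ⟨alternate w fun v => if v = ordering v.toFace then x v.toFace else 0, fun F => ?_⟩
  simp [alternate, OrdFace.perm_eq_self_iff]

lemma eq_of_eval_ordering_eq {f g : Cochain K w n}
    (h : ∀ F, f.eval (ordering F) = g.eval (ordering F)) : f = g := by
  refine ext_eval fun v => ?_
  obtain ⟨σ, hσ⟩ := OrdFace.exists_perm (simplex_ordering v.toFace).symm
  rw [hσ, eval_perm, eval_perm, h]

/-- A cochain is determined by its values at the reference orderings, which are arbitrary. -/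
noncomputable def evalOrderingEquiv (w : Weight K) (n : ℕ) :
    Cochain K w n ≃ₗ[ℝ] (K.Face n → ℝ) :=
  LinearEquiv.ofBijective
    { toFun f F := f.eval (ordering F)
      map_add' _ _ := rfl
      map_smul' _ _ := rfl }
    ⟨fun _ _ h => eq_of_eval_ordering_eq (congrFun h),
      fun x => (exists_eval_ordering_eq w x).imp fun _ => funext⟩

lemma finrank_eq_card [Fintype V] : Module.finrank ℝ (Cochain K w n) = Fintype.card (K.Face n) :=
  (evalOrderingEquiv w n).finrank_eq.trans (Module.finrank_fintype_fun_eq_card ℝ)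

end Cochain

end Cochains

section Nondegenerate

variable {V W : Type*} [DecidableEq W] {φ : V → W} {K : SimpComplex V} {M : SimpComplex W}
  {n : ℕ}

lemma map_univ_eq_image {u : Fin n ↪ W} {v : Fin n ↪ V} (h : ∀ j, u j = φ (v j)) :
    Finset.univ.map u = (Finset.univ.map v).image φ := by
  ext x
  simp only [Finset.mem_map, Finset.mem_image, Finset.mem_univ, true_and,
    exists_exists_eq_and, h]

/-- `φ` is a simplicial map `K → M` that is injective on each simplex, so that cochains can be
pulled back along it. -/
structure IsNondegenerate (φ : V → W) (K : SimpComplex V) (M : SimpComplex W) : Prop where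
  image_mem : ∀ F ∈ K.faces, F.image φ ∈ M.faces
  injOn : ∀ F ∈ K.faces, Set.InjOn φ F

namespace IsNondegenerate

lemma card_image (h : IsNondegenerate φ K M) {F : Finset V} (hF : F ∈ K.faces) :
    (F.image φ).card = F.card :=
  Finset.card_image_of_injOn (h.injOn F hF)

/-- The image of a simplex of `K`, as a map `S_{n-1}(K) → S_{n-1}(M)`. -/
def face (h : IsNondegenerate φ K M) (F : K.Face n) : M.Face n :=
  ⟨⟨F.1.1.image φ, h.image_mem _ F.1.2⟩, (h.card_image F.1.2).trans F.2⟩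

/-- The image `(φ v_0, …, φ v_{n-1})` of an ordered simplex of `K`. -/
def ordFace (h : IsNondegenerate φ K M) (v : OrdFace K n) : OrdFace M n :=
  ⟨⟨fun j => φ (v.1 j), fun _ _ hab => v.1.injective
    (h.injOn _ v.2 (Finset.mem_map_of_mem _ (Finset.mem_univ _))
      (Finset.mem_map_of_mem _ (Finset.mem_univ _)) hab)⟩, by
    rw [map_univ_eq_image fun _ => rfl]
    exact h.image_mem _ v.2⟩

lemma toFace_ordFace (h : IsNondegenerate φ K M) (v : OrdFace K n) :
    (h.ordFace v).toFace = h.face v.toFace :=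
  Subtype.ext (Subtype.ext (map_univ_eq_image fun _ => rfl))

lemma ordFace_perm (h : IsNondegenerate φ K M) (v : OrdFace K n) (σ : Equiv.Perm (Fin n)) :
    h.ordFace (v.perm σ) = (h.ordFace v).perm σ := rfl

lemma ordFace_del (h : IsNondegenerate φ K M) (v : OrdFace K (n + 1)) (j : Fin (n + 1)) :
    h.ordFace (v.del j) = (h.ordFace v).del j := rfl

/-- The pullback of cochains along `φ`, multiplied by the function `c` of the simplex. -/
noncomputable def pullback (h : IsNondegenerate φ K M) (wK : Weight K) (wM : Weight M)
    (c : K.Face n → ℝ) : Cochain M wM n →ₗ[ℝ] Cochain K wK n where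
  toFun f := Cochain.mk (fun v => c v.toFace * f.eval (h.ordFace v)) fun v σ => by
    rw [OrdFace.toFace_perm, h.ordFace_perm, Cochain.eval_perm, mul_left_comm]
  map_add' _ _ := Cochain.ext_eval fun _ => mul_add ..
  map_smul' _ _ := Cochain.ext_eval fun _ => mul_left_comm ..

variable {wK : Weight K} {wM : Weight M}

lemma eval_pullback (h : IsNondegenerate φ K M) (c : K.Face n → ℝ) (f : Cochain M wM n)
    (v : OrdFace K n) :
    (h.pullback wK wM c f).eval v = c v.toFace * f.eval (h.ordFace v) := rfl

lemma coboundaryWith_pullback (h : IsNondegenerate φ K M) {r : K.Simplex → K.Simplex → ℝ}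
    {s : M.Simplex → M.Simplex → ℝ} {c : K.Face n → ℝ} {c' : K.Face (n + 1) → ℝ}
    (hc : ∀ (F : K.Face n) (F' : K.Face (n + 1)), IsFacetOf F.1.1 F'.1.1 →
      r F.1 F'.1 * c F = c' F' * s (h.face F).1 (h.face F').1) (f : Cochain M wM n) :
    coboundaryWith wK r n (h.pullback wK wM c f) =
      h.pullback wK wM c' (coboundaryWith wM s n f) := by
  refine Cochain.ext_eval fun v => ?_
  rw [eval_pullback, Cochain.eval_coboundaryWith, Cochain.eval_coboundaryWith, Finset.mul_sum]
  refine Finset.sum_congr rfl fun j _ => ?_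
  have hj : r (v.del j).simplex v.simplex * c (v.del j).toFace =
      c' v.toFace * s ((h.ordFace v).del j).simplex (h.ordFace v).simplex := by
    have hdel := hc _ _ (v.isFacetOf_del j)
    rwa [← h.toFace_ordFace, ← h.toFace_ordFace, h.ordFace_del] at hdel
  rw [eval_pullback, h.ordFace_del]
  linear_combination (-1) ^ (j : ℕ) * f.eval ((h.ordFace v).del j) * hj

variable [Fintype V] [Fintype W]

lemma inner_pullback (h : IsNondegenerate φ K M)
    (hw : ∀ F : K.Face n, wK.val F.1 = wM.val (h.face F).1) {A : Type*} [Fintype A]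
    {s : K.Face n → A} (hs : IsSheetLabelling h.face s) (c d : A → ℝ) (f g : Cochain M wM n) :
    inner ℝ (h.pullback wK wM (c ∘ s) f) (h.pullback wK wM (d ∘ s) g) =
      (∑ a, c a * d a) * inner ℝ f g := by
  rw [Cochain.inner_eq_sum, Cochain.inner_eq_sum, mul_comm, ← hs.sum_mul]
  refine Finset.sum_congr rfl fun F _ => ?_
  have hF : (h.ordFace (ordering F)).simplex = (ordering (h.face F)).simplex := by
    rw [simplex_ordering]
    exact congrArg Subtype.val ((h.toFace_ordFace _).trans (by rw [toFace_ordering]))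
  simp only [eval_pullback, toFace_ordering, Function.comp_apply, hw]
  linear_combination c (s F) * d (s F) * wM.val (h.face F).1 * Cochain.eval_mul_eval_eq f g hF

end IsNondegenerate

/-- The sign character of `𝕊₂`, as a function on two sheets. -/
def sheetSign : Fin 2 → ℤ := ![1, -1]

lemma sheetSign_perm_apply : ∀ (π : Equiv.Perm (Fin 2)) (a : Fin 2),
    sheetSign (π a) = sheetSign a * (Equiv.Perm.sign π : ℤ) := by
  decide

namespace IsNondegenerate

lemma isOrthogonalSum_pullback [Fintype V] [Fintype W] {wK : Weight K} {wM : Weight M}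
    (h : IsNondegenerate φ K M) (hw : ∀ F : K.Face n, wK.val F.1 = wM.val (h.face F).1)
    {s : K.Face n → Fin 2} (hs : IsSheetLabelling h.face s) :
    IsOrthogonalSum (2 : ℝ) (h.pullback wK wM ((fun _ => 1) ∘ s))
      (h.pullback wK wM ((fun a => (sheetSign a : ℝ)) ∘ s)) where
  scale_ne_zero := two_ne_zero
  inner_left f g := by simp [h.inner_pullback hw hs]
  inner_right f g := by
    rw [h.inner_pullback hw hs]
    norm_num [sheetSign]
  inner_left_right f g := by simp [h.inner_pullback hw hs, sheetSign]
  finrank_eq := by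
    simp only [Cochain.finrank_eq_card, Fintype.card_of_bijective hs, Fintype.card_prod,
      Fintype.card_fin, mul_two]

end IsNondegenerate

end Nondegenerate

section IncidenceGraphs

variable {V W : Type*} {K : SimpComplex V} {M : SimpComplex W} {φ : V → W} {n k : ℕ}

lemma incidenceGraphSimplex_injective :
    Function.Injective (incidenceGraphSimplex : K.Face n ⊕ K.Face (n + 1) → K.Simplex) := by
  refine Subtype.val_injective.sumElim Subtype.val_injective fun F F' h => ?_
  exact n.succ_ne_self (F'.2.symm.trans ((congrArg (fun E => E.1.card) h.symm).trans F.2))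

lemma bijOn_neighborSet_inl (F : K.Face n) :
    Set.BijOn (fun y => (incidenceGraphSimplex y).1) ((incidenceGraph K n).neighborSet (.inl F))
      {F' | F' ∈ K.faces ∧ IsFacetOf F.1.1 F'} := by
  refine ⟨?_, (Subtype.val_injective.comp incidenceGraphSimplex_injective).injOn, ?_⟩
  · rintro (_ | F') hF'
    · exact hF'.elim
    · exact ⟨F'.1.2, hF'⟩
  · rintro F' ⟨hF', hFF'⟩
    exact ⟨.inr ⟨⟨F', hF'⟩, hFF'.2.trans (congrArg (· + 1) F.2)⟩, hFF', rfl⟩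

lemma bijOn_neighborSet_inr (F' : K.Face (n + 1)) :
    Set.BijOn (fun y => (incidenceGraphSimplex y).1) ((incidenceGraph K n).neighborSet (.inr F'))
      {F | IsFacetOf F F'.1.1} := by
  refine ⟨?_, (Subtype.val_injective.comp incidenceGraphSimplex_injective).injOn, ?_⟩
  · rintro (F | _) hF
    · exact hF
    · exact hF.elim
  · intro F hF
    exact ⟨.inl ⟨⟨F, K.down_closed _ F'.1.2 F hF.1⟩, Nat.succ_injective (hF.2.symm.trans F'.2)⟩,
      hF, rfl⟩

lemma exists_isSignOf (ψ : VoltageAssignment (incidenceGraph M n) k) :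
    ∃ s : IncidenceSign M, IsSignOf s ψ := by
  classical
  let u (F F' : M.Simplex) : ℤˣ :=
    if h : ∃ (_ : F.1.card = n) (_ : F'.1.card = n + 1), IsFacetOf F.1 F'.1 then
      Equiv.Perm.sign (ψ.val ⟨(.inl ⟨F, h.1⟩, .inr ⟨F', h.2.1⟩), h.2.2⟩)
    else 1
  have hu (F : M.Face n) (F' : M.Face (n + 1))
      (h : (incidenceGraph M n).Adj (.inl F) (.inr F')) :
      u F.1 F'.1 = Equiv.Perm.sign (ψ.val ⟨(.inl F, .inr F'), h⟩) := dif_pos ⟨F.2, F'.2, h⟩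
  refine ⟨{ val := fun F F' => if IsFacetOf F.1 F'.1 then u F F' else 0
            of_incident := fun F F' h => ?_
            of_not_incident := fun F F' h => if_neg h }, fun F F' h => ?_⟩
  · rw [if_pos h, ← Int.isUnit_iff]
    exact (u F F').isUnit
  · exact (if_pos h).trans (congrArg Units.val (hu F F' h))

namespace IsNondegenerate

variable [DecidableEq W]

/-- The map of incidence graphs induced by `φ`. -/
def node (h : IsNondegenerate φ K M) : K.Face n ⊕ K.Face (n + 1) → M.Face n ⊕ M.Face (n + 1) :=
  Sum.map h.face h.face

lemma incidenceGraphSimplex_node (h : IsNondegenerate φ K M) (y : K.Face n ⊕ K.Face (n + 1)) :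
    (incidenceGraphSimplex (h.node y)).1 = (incidenceGraphSimplex y).1.image φ := by
  rcases y with F | F <;> rfl

variable {ψ : VoltageAssignment (incidenceGraph M n) k} {η : derivedGraph ψ ≃g incidenceGraph K n}

lemma isCompatible_iff (h : IsNondegenerate φ K M) :
    IsCompatible φ η ↔ ∀ y, (η.symm y).1 = h.node y := by
  calc IsCompatible φ η
    _ ↔ ∀ q, h.node (η q) = q.1 := by
      simp only [IsCompatible, Prod.forall, ← h.incidenceGraphSimplex_node, Subtype.val_inj,
        incidenceGraphSimplex_injective.eq_iff]
    _ ↔ ∀ y, (η.symm y).1 = h.node y := by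
      rw [η.symm.surjective.forall]
      simp only [RelIso.apply_symm_apply, eq_comm]

lemma isSheetLabelling_of_isCompatible (h : IsNondegenerate φ K M) (hη : IsCompatible φ η) :
    IsSheetLabelling h.node fun y => (η.symm y).2 := by
  have hη_symm : (fun y => (h.node y, (η.symm y).2)) = η.symm :=
    funext fun y => Prod.ext (h.isCompatible_iff.1 hη y).symm rfl
  exact (congrArg Function.Bijective hη_symm).mpr η.symm.bijective

lemma sheetSign_eq_mul_of_isFacetOf {ψ : VoltageAssignment (incidenceGraph M n) 2}
    {η : derivedGraph ψ ≃g incidenceGraph K n} (h : IsNondegenerate φ K M)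
    (hη : IsCompatible φ η) {s : IncidenceSign M} (hs : IsSignOf s ψ) {F : K.Face n}
    {F' : K.Face (n + 1)} (hF : IsFacetOf F.1.1 F'.1.1) :
    sheetSign (η.symm (.inl F)).2 =
      sheetSign (η.symm (.inr F')).2 * s.val (h.face F).1 (h.face F').1 := by
  have hy (y) : η.symm y = (h.node y, (η.symm y).2) := Prod.ext (h.isCompatible_iff.1 hη y) rfl
  have hadj : (derivedGraph ψ).Adj (η.symm (.inl F)) (η.symm (.inr F')) :=
    η.symm.map_adj_iff.2 hF
  rw [hy, hy (.inr F')] at hadj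
  obtain ⟨hG, hlabel⟩ := hadj
  rw [hs _ _ hG, ← sheetSign_perm_apply]
  exact congrArg sheetSign hlabel

theorem spec_downLaplacian_eq_add [Fintype V] [Fintype W] {wK : Weight K} {wM : Weight M}
    {ψ : VoltageAssignment (incidenceGraph M n) 2} {η : derivedGraph ψ ≃g incidenceGraph K n}
    (h : IsNondegenerate φ K M) (hη : IsCompatible φ η)
    (hw : ∀ F : K.Face n, wK.val F.1 = wM.val (h.face F).1)
    (hw' : ∀ F : K.Face (n + 1), wK.val F.1 = wM.val (h.face F).1)
    {s : IncidenceSign M} (hs : IsSignOf s ψ) :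
    spec (downLaplacian K wK n) =
      spec (downLaplacian M wM n) + spec (signedDownLaplacian M wM s n) := by
  obtain ⟨hl, hl'⟩ := isSheetLabelling_sumMap.1 (h.isSheetLabelling_of_isCompatible hη)
  have hsign (F : K.Face n) (F' : K.Face (n + 1)) (hF : IsFacetOf F.1.1 F'.1.1) :
      (1 : ℝ) * sheetSign (η.symm (.inl F)).2 =
        sheetSign (η.symm (.inr F')).2 * s.val (h.face F).1 (h.face F').1 := by
    rw [one_mul]
    exact_mod_cast h.sheetSign_eq_mul_of_isFacetOf hη hs hF
  have hcharpoly : (downLaplacian K wK n).charpoly =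
      (downLaplacian M wM n).charpoly * (signedDownLaplacian M wM s n).charpoly :=
    (h.isOrthogonalSum_pullback hw hl).charpoly_comp_adjoint (h.isOrthogonalSum_pullback hw' hl')
      (h.coboundaryWith_pullback fun _ _ _ => rfl)
      (h.coboundaryWith_pullback hsign)
  unfold spec
  rw [hcharpoly, Polynomial.roots_mul]
  exact mul_ne_zero (LinearMap.charpoly_monic _).ne_zero (LinearMap.charpoly_monic _).ne_zero

end IsNondegenerate

end IncidenceGraphs

section SheetedCoverings

variable {V W : Type*} [DecidableEq W] {φ : V → W} {K : SimpComplex V} {M : SimpComplex W}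
  {n k : ℕ} {F F' : Finset V}

/-- A `k`-fold covering whose total space `K` need not be connected. That the preimage of a simplex
`G` is the union of the simplices over `G` follows from the lifting of incidences. -/
structure IsSheetedCovering (k : ℕ) (φ : V → W) (K : SimpComplex V) (M : SimpComplex W) : Prop
    extends IsNondegenerate φ K M where
  pairwise_disjoint : ∀ G ∈ M.faces, (lifts φ K G).Pairwise Disjoint
  lift_incidence : ∀ G ∈ M.faces, ∀ G' ∈ M.faces, IsFacetOf G G' →
    ∀ F ∈ lifts φ K G, ∃ F' ∈ lifts φ K G', IsFacetOf F F'
  degree : ∀ G ∈ M.faces, G.Nonempty → (lifts φ K G).ncard = k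

lemma IsFoldCovering.isSheetedCovering [DecidableEq V] (h : IsFoldCovering k φ K M) :
    IsSheetedCovering k φ K M where
  image_mem := h.simplicial
  injOn F hF := (h.bijOn _ (h.simplicial F hF) F ⟨hF, rfl⟩).injOn
  pairwise_disjoint := h.pairwise_disjoint
  lift_incidence := h.lift_incidence
  degree := h.degree

namespace IsNondegenerate

lemma isFacetOf_image (h : IsNondegenerate φ K M) (hF' : F' ∈ K.faces) (hF : IsFacetOf F F') :
    IsFacetOf (F.image φ) (F'.image φ) := by
  refine ⟨Finset.image_subset_image hF.1, ?_⟩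
  rw [h.card_image hF', h.card_image (K.down_closed F' hF' F hF.1), hF.2]

lemma bijOn_image_facets (h : IsNondegenerate φ K M) (hF' : F' ∈ K.faces) :
    Set.BijOn (Finset.image φ) {F | IsFacetOf F F'} {G | IsFacetOf G (F'.image φ)} := by
  refine ⟨fun F hF => h.isFacetOf_image hF' hF, ?_, ?_⟩
  · exact (Finset.image_injOn_powerset_of_injOn (h.injOn F' hF')).mono
      fun F hF => Finset.mem_coe.2 (Finset.mem_powerset.2 hF.1)
  · rintro G ⟨hG, hcard⟩
    obtain ⟨F, hF, rfl⟩ := Finset.subset_image_iff.1 hG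
    rw [h.card_image hF', h.card_image (K.down_closed F' hF' F hF)] at hcard
    exact ⟨F, ⟨hF, hcard⟩, rfl⟩

lemma image_coe_fibre_face (h : IsNondegenerate φ K M) (G : M.Face n) :
    (fun F : K.Face n => F.1.1) '' {F | h.face F = G} = lifts φ K G.1.1 := by
  ext F
  constructor
  · rintro ⟨F, rfl, rfl⟩
    exact ⟨F.1.2, rfl⟩
  · rintro ⟨hF, hFG⟩
    exact ⟨⟨⟨F, hF⟩, by rw [← h.card_image hF, hFG, G.2]⟩, Subtype.ext (Subtype.ext hFG), rfl⟩

end IsNondegenerate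

namespace IsSheetedCovering

lemma bijOn_image_cofacets (h : IsSheetedCovering k φ K M) (hF : F ∈ K.faces) (hne : F.Nonempty) :
    Set.BijOn (Finset.image φ) {F' | F' ∈ K.faces ∧ IsFacetOf F F'}
      {G' | G' ∈ M.faces ∧ IsFacetOf (F.image φ) G'} := by
  refine ⟨fun F' hF' => ⟨h.image_mem F' hF'.1, h.isFacetOf_image hF'.1 hF'.2⟩, ?_, ?_⟩
  · rintro F₁ ⟨hF₁, hsub₁, -⟩ F₂ ⟨hF₂, hsub₂, -⟩ himage
    by_contra hF₁₂
    obtain ⟨v, hv⟩ := hne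
    exact Finset.disjoint_left.1
      (h.pairwise_disjoint _ (h.image_mem F₂ hF₂) ⟨hF₁, himage⟩ ⟨hF₂, rfl⟩ hF₁₂)
      (hsub₁ hv) (hsub₂ hv)
  · rintro G' ⟨hG', hFG'⟩
    obtain ⟨F', ⟨hF', rfl⟩, hFF'⟩ :=
      h.lift_incidence _ (h.image_mem F hF) G' hG' hFG' F ⟨hF, rfl⟩
    exact ⟨F', ⟨hF', hFF'⟩, rfl⟩

lemma isGraphCovering_node (h : IsSheetedCovering k φ K M) (hn : 1 ≤ n) :
    IsGraphCovering (incidenceGraph K n) (incidenceGraph M n) h.node := by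
  have hsimplex : (fun x : M.Face n ⊕ M.Face (n + 1) => (incidenceGraphSimplex x).1) ∘ h.node =
      Finset.image φ ∘ fun y => (incidenceGraphSimplex y).1 :=
    funext h.incidenceGraphSimplex_node
  have hinj : Function.Injective fun x : M.Face n ⊕ M.Face (n + 1) =>
      (incidenceGraphSimplex x).1 :=
    Subtype.val_injective.comp incidenceGraphSimplex_injective
  rintro (F | F')
  · have hbij := (h.bijOn_image_cofacets F.1.2 (Finset.card_pos.1 (hn.trans_eq F.2.symm))).comp
      (bijOn_neighborSet_inl F)
    exact bijOn_of_bijOn_comp hinj (hsimplex ▸ hbij) (bijOn_neighborSet_inl (h.face F))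
  · have hbij := (h.bijOn_image_facets F'.1.2).comp (bijOn_neighborSet_inr F')
    exact bijOn_of_bijOn_comp hinj (hsimplex ▸ hbij) (bijOn_neighborSet_inr (h.face F'))

lemma exists_isSheetLabelling_face [NeZero k] (h : IsSheetedCovering k φ K M) (hn : 1 ≤ n) :
    ∃ s : K.Face n → Fin k, IsSheetLabelling h.face s := by
  refine exists_isSheetLabelling fun G => ?_
  have hdegree := h.degree G.1.1 G.1.2 (Finset.card_pos.1 (hn.trans_eq G.2.symm))
  have hinj : Function.Injective fun F : K.Face n => F.1.1 :=
    Subtype.val_injective.comp Subtype.val_injective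
  rwa [← h.image_coe_fibre_face G, Set.ncard_image_of_injective _ hinj] at hdegree

theorem exists_isCompatible [NeZero k] (h : IsSheetedCovering k φ K M) (hn : 1 ≤ n) :
    ∃ (ψ : VoltageAssignment (incidenceGraph M n) k)
      (η : derivedGraph ψ ≃g incidenceGraph K n), IsCompatible φ η := by
  obtain ⟨s, hs⟩ := h.exists_isSheetLabelling_face hn
  obtain ⟨s', hs'⟩ := h.exists_isSheetLabelling_face (Nat.le_succ_of_le hn)
  have hlabel : IsSheetLabelling h.node (Sum.elim s s') :=
    isSheetLabelling_sumMap.2 ⟨hs, hs'⟩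
  obtain ⟨ψ, η, hη⟩ := (h.isGraphCovering_node hn).exists_derivedGraph_iso hlabel
  exact ⟨ψ, η, h.isCompatible_iff.2 fun y => congrArg Prod.fst (hη y)⟩

end IsSheetedCovering

end SheetedCoverings

end CoverLap

theorem mainTheorem7_general {V W : Type*} [Fintype V] [Fintype W] [DecidableEq W]
    (K : SimpComplex V) (M : SimpComplex W) (φ : V → W) (hφ : IsSheetedCovering 2 φ K M)
    (wK : Weight K) (wM : Weight M) (i : ℕ) (hi : 1 ≤ i)
    (hw : ∀ (F : K.Simplex) (G : M.Simplex), F.1.card = i ∨ F.1.card = i + 1 →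
      F.1.image φ = G.1 → wK.val F = wM.val G) :
    (∃ (ψ : VoltageAssignment (incidenceGraph M i) 2)
      (η : derivedGraph ψ ≃g incidenceGraph K i), IsCompatible φ η) ∧
    ∀ (ψ : VoltageAssignment (incidenceGraph M i) 2)
      (η : derivedGraph ψ ≃g incidenceGraph K i), IsCompatible φ η →
      (∃ s : IncidenceSign M, IsSignOf s ψ) ∧
      ∀ s : IncidenceSign M, IsSignOf s ψ →
        spec (downLaplacian K wK i) =
          spec (downLaplacian M wM i) + spec (signedDownLaplacian M wM s i) :=
  ⟨hφ.exists_isCompatible hi, fun ψ _ hη => ⟨exists_isSignOf ψ, fun _ hs =>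
    hφ.spec_downLaplacian_eq_add hη (fun F => hw F.1 _ (.inl F.2) rfl)
      (fun F => hw F.1 _ (.inr F.2) rfl) hs⟩⟩

theorem mainTheorem7 {V W : Type*} [Fintype V] [Fintype W] [DecidableEq V] [DecidableEq W]
    (K : SimpComplex V) (M : SimpComplex W) (φ : V → W) (hφ : IsFoldCovering 2 φ K M)
    (wK : Weight K) (wM : Weight M) (i : ℕ) (hi : 1 ≤ i)
    (hw : ∀ (F : K.Simplex) (G : M.Simplex), F.1.card = i ∨ F.1.card = i + 1 →
      F.1.image φ = G.1 → wK.val F = wM.val G) :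
    (∃ (ψ : VoltageAssignment (incidenceGraph M i) 2)
      (η : derivedGraph ψ ≃g incidenceGraph K i), IsCompatible φ η) ∧
    ∀ (ψ : VoltageAssignment (incidenceGraph M i) 2)
      (η : derivedGraph ψ ≃g incidenceGraph K i), IsCompatible φ η →
      (∃ s : IncidenceSign M, IsSignOf s ψ) ∧
      ∀ s : IncidenceSign M, IsSignOf s ψ →
        spec (downLaplacian K wK i) =
          spec (downLaplacian M wM i) + spec (signedDownLaplacian M wM s i) :=
  mainTheorem7_general K M φ hφ.isSheetedCovering wK wM i hi hw
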